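/- For integers $n \ge 3$ and $1 \le k < n/2$, let $GP(n,k)$ be the generalized Petersen graph, with vertex set $\{u_i : i \in \mathbb{Z}_n\} \cup \{v_i : i \in \mathbb{Z}_n\}$ and edges $u_iu_{i+1}$, $v_iv_{i+k}$ and $u_iv_i$ for $i \in \mathbb{Z}_n$ (indices modulo $n$). For vertices $x,y$ of a connected graph $G$ with distance function $d_G$, put $W_{xy} = \{w \in V(G) : d_G(w,x) < d_G(w,y)\}$. For $1 \le \ell \le \mathrm{diam}(G)$, a finite connected graph $G$ is called $\ell$-distance-balanced if $|W_{xy}| = |W_{yx}|$ for all $x,y \in V(G)$ with $d_G(x,y) = \ell$. Let $n$ and $k$ be integers with $2 \le k < n/2$. (i) If $k \ge 6$ is even and $n > \frac{5}{4}k^2 + 2k$, then $GP(n,k)$ is not $2$-distance-balanced. (ii) If $k \ge 5$ is odd and $n > \frac{7}{4}k^2 + \frac{3}{4}k$, then $GP(n,k)$ is not $2$-distance-balanced. (iii) If $k = 2$ and $n > 10$, or $k = 3$ and $n > 10$, or $k = 4$ and $n > 21$, then $GP(n,k)$ is not $2$-distance-balanced. In addition, $GP(10,2)$, $GP(10,3)$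 and $GP(21,4)$ are $2$-distance-balanced. -/

import Mathlib

/-- The generalized Petersen graph `GP(n, k)`. The outer vertex `u_i` is `Sum.inl i` and the inner
vertex `v_i` is `Sum.inr i`, with indices in `ZMod n`. The edges are `u_i u_{i+1}`, `v_i v_{i+k}`
and `u_i v_i`; `SimpleGraph.fromRel` symmetrizes the relation (and would delete loops, of which
there are none when `1 ≤ k < n / 2`). -/
def generalizedPetersen (n k : ℕ) : SimpleGraph (ZMod n ⊕ ZMod n) :=
  SimpleGraph.fromRel fun x y =>
    (∃ i : ZMod n, x = Sum.inl i ∧ y = Sum.inl (i + 1)) ∨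
    (∃ i : ZMod n, x = Sum.inr i ∧ y = Sum.inr (i + (k : ZMod n))) ∨
    (∃ i : ZMod n, x = Sum.inl i ∧ y = Sum.inr i)

/-- The set `W_{xy}` of vertices that are closer to `x` than to `y`. -/
def SimpleGraph.closerSet {V : Type*} (G : SimpleGraph V) (x y : V) : Set V :=
  {w | G.dist w x < G.dist w y}

/-- The vertices `x` and `y` are balanced: `|W_{xy}| = |W_{yx}|`. -/
def SimpleGraph.IsBalancedPair {V : Type*} (G : SimpleGraph V) (x y : V) : Prop :=
  (G.closerSet x y).ncard = (G.closerSet y x).ncard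

/-- `G` is `ℓ`-distance-balanced: every two vertices at distance `ℓ` are balanced. The notion is
meant for finite connected graphs `G` and `1 ≤ ℓ ≤ diam G`. -/
def SimpleGraph.IsDistanceBalanced {V : Type*} (G : SimpleGraph V) (l : ℕ) : Prop :=
  ∀ x y : V, G.dist x y = l → G.IsBalancedPair x y

/-- Generalized Petersen graphs are connected, so `SimpleGraph.dist` is the true distance there. -/
theorem generalizedPetersen_connected (n k : ℕ) (hn : 1 < n) :
    (generalizedPetersen n k).Connected := by
  have : NeZero n := ⟨by omega⟩
  have : Fact (1 < n) := ⟨hn⟩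
  have hu : ∀ m : ℕ, (generalizedPetersen n k).Reachable (Sum.inl 0) (Sum.inl (m : ZMod n)) := by
    intro m
    induction m with
    | zero => simp
    | succ m ih =>
      refine ih.trans (SimpleGraph.Adj.reachable ?_)
      rw [generalizedPetersen, SimpleGraph.fromRel_adj]
      refine ⟨by simp, Or.inl (Or.inl ⟨m, rfl, by simp⟩)⟩
  have hu' : ∀ i : ZMod n, (generalizedPetersen n k).Reachable (Sum.inl 0) (Sum.inl i) := by
    intro i
    have := hu i.val
    rwa [ZMod.natCast_zmod_val] at this
  have h0 : ∀ x, (generalizedPetersen n k).Reachable (Sum.inl 0) x := by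
    rintro (i | i)
    · exact hu' i
    · refine (hu' i).trans (SimpleGraph.Adj.reachable ?_)
      rw [generalizedPetersen, SimpleGraph.fromRel_adj]
      exact ⟨by simp, Or.inl (Or.inr (Or.inr ⟨i, rfl, rfl⟩))⟩
  have : Nonempty (ZMod n ⊕ ZMod n) := ⟨Sum.inl 0⟩
  exact ⟨fun x y => (h0 x).symm.trans (h0 y)⟩

/-- The diameter of a generalized Petersen graph is at least `2`. -/
theorem two_le_diam_generalizedPetersen (n k : ℕ) (hn : 1 < n) :
    2 ≤ (generalizedPetersen n k).diam := by
  have : NeZero n := ⟨by omega⟩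
  have : Fact (1 < n) := ⟨hn⟩
  have hc := generalizedPetersen_connected n k hn
  have := hc.nonempty
  refine le_trans ?_ (SimpleGraph.dist_le_diam (u := Sum.inl 0) (v := Sum.inr 1)
    (SimpleGraph.connected_iff_ediam_ne_top.mp hc))
  have h0 : (generalizedPetersen n k).dist (Sum.inl 0) (Sum.inr 1) ≠ 0 := by
    rw [Ne, hc.dist_eq_zero_iff]
    simp
  have h1 : (generalizedPetersen n k).dist (Sum.inl 0) (Sum.inr 1) ≠ 1 := by
    rw [Ne, SimpleGraph.dist_eq_one_iff_adj, generalizedPetersen, SimpleGraph.fromRel_adj]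
    simp
  omega

namespace GeneralizedPetersen

open Finset

/-! Distances in `GP(n, k)` come from word lengths over `±1, ±k` in `ZMod n`. A path between an
outer and an inner vertex needs one spoke. Between two outer vertices it either stays on the outer
cycle or takes two spokes and any word; between two inner vertices the spokes are saved only by
words using `±k` alone (`dist_inl_inr`, `dist_inl_inl`, `dist_inr_inr`). Reflections balance every
pair of the same kind, so only the pairs `u_i`, `v_{i+s}` with `s` of word length 1 matter, and each
amounts to a finite sum, `imbalance n k s`. For `s = k`, replace both same-kind distances by word
length plus 2: outer and inner terms then cancel. What remains is `gain` minus `loss`, the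
corrections from paths that avoid spokes. Multiples `b * k` with `|b|` small each gain at least 1,
giving at least `2 * B` when `(2 * B - 1) * k < n`. Loss occurs only in a window of about `k`
residues near 0, at most 1 each except possibly 2 at `k / 2`. For large `n` gain exceeds loss; the
remaining cases are finite computations. -/

/-- The distance from `x` to `0` in the cycle `ZMod n`. -/
def circNorm {n : ℕ} (x : ZMod n) : ℕ := x.valMinAbs.natAbs

/-- The word length of `j : ZMod n` with respect to the generators `±1, ±k`. -/
def wordNorm (n k : ℕ) [NeZero n] (j : ZMod n) : ℕ :=
  univ.inf' univ_nonempty fun c : ZMod n => circNorm c + circNorm (j - c * (k : ZMod n))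

/-- The distance between two outer vertices of `GP(n, k)` whose indices differ by `j`. -/
def outerDist (n k : ℕ) [NeZero n] (j : ZMod n) : ℕ := min (circNorm j) (wordNorm n k j + 2)

/-- The distance between two inner vertices of `GP(n, k)` whose indices differ by `j`. -/
def innerDist (n k : ℕ) [NeZero n] (j : ZMod n) : ℕ :=
  univ.inf' univ_nonempty fun c : ZMod n =>
    circNorm c + circNorm (j - c * (k : ZMod n)) + if j = c * k then 0 else 2

/-- The difference `|W_{yx}| - |W_{xy}|` for `x = u_i` and `y = v_{i+s}`. -/
def imbalance (n k : ℕ) [NeZero n] (s : ZMod n) : ℤ :=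
  ∑ j : ZMod n, (((outerDist n k j : ℤ) - (wordNorm n k (j - s) + 1)).sign -
    ((innerDist n k j : ℤ) - (wordNorm n k (j - s) + 1)).sign)

/-! ### Cyclic norm and word length -/

theorem circNorm_neg {n : ℕ} (x : ZMod n) : circNorm (-x) = circNorm x :=
  ZMod.natAbs_valMinAbs_neg x

theorem circNorm_zero (n : ℕ) : circNorm (0 : ZMod n) = 0 := by simp [circNorm]

theorem circNorm_add_le {n : ℕ} (x y : ZMod n) : circNorm (x + y) ≤ circNorm x + circNorm y :=
  (ZMod.natAbs_valMinAbs_add_le x y).trans (Int.natAbs_add_le _ _)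

theorem intCast_valMinAbs {n : ℕ} (x : ZMod n) : ((x.valMinAbs : ℤ) : ZMod n) = x :=
  ZMod.coe_valMinAbs x

theorem circNorm_intCast_le {n : ℕ} (a : ℤ) : circNorm (a : ZMod n) ≤ a.natAbs := by
  rcases Nat.eq_zero_or_pos n with rfl | hn
  · simp only [circNorm, ZMod.valMinAbs]; exact le_rfl
  have : NeZero n := ⟨hn.ne'⟩
  apply ZMod.natAbs_min_of_le_div_two n
  · rw [intCast_valMinAbs]
  · exact ZMod.natAbs_valMinAbs_le _

theorem circNorm_one_le (n : ℕ) : circNorm (1 : ZMod n) ≤ 1 := by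
  simpa using circNorm_intCast_le (n := n) 1

section Norms

variable {n k : ℕ} [NeZero n]

theorem wordNorm_le (c j : ZMod n) : wordNorm n k j ≤ circNorm c + circNorm (j - c * (k : ZMod n)) :=
  inf'_le (fun c : ZMod n => circNorm c + circNorm (j - c * (k : ZMod n))) (mem_univ c)

theorem exists_wordNorm_eq (k : ℕ) (j : ZMod n) :
    ∃ c : ZMod n, wordNorm n k j = circNorm c + circNorm (j - c * (k : ZMod n)) := by
  obtain ⟨c, -, hc⟩ := exists_mem_eq_inf' univ_nonempty
    (fun c : ZMod n => circNorm c + circNorm (j - c * (k : ZMod n)))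
  exact ⟨c, hc⟩

theorem innerDist_le (c j : ZMod n) :
    innerDist n k j ≤ circNorm c + circNorm (j - c * (k : ZMod n)) + if j = c * k then 0 else 2 :=
  inf'_le (fun c : ZMod n => circNorm c + circNorm (j - c * (k : ZMod n)) + if j = c * k then 0 else 2)
    (mem_univ c)

theorem exists_innerDist_eq (k : ℕ) (j : ZMod n) :
    ∃ c : ZMod n,
      innerDist n k j = circNorm c + circNorm (j - c * (k : ZMod n)) + if j = c * k then 0 else 2 := by
  obtain ⟨c, -, hc⟩ := exists_mem_eq_inf' univ_nonempty
    (fun c : ZMod n => circNorm c + circNorm (j - c * (k : ZMod n)) + if j = c * k then 0 else 2)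
  exact ⟨c, hc⟩

/-- Every representation `j = a + b * k` bounds the word length of `j`. -/
theorem wordNorm_le_of_eq {j : ZMod n} (a b : ℤ) (h : j = (a : ZMod n) + (b : ZMod n) * k) :
    wordNorm n k j ≤ a.natAbs + b.natAbs := by
  refine (wordNorm_le (b : ZMod n) j).trans ?_
  have h1 : j - (b : ZMod n) * k = (a : ZMod n) := by rw [h]; ring
  rw [h1, add_comm]
  exact add_le_add (circNorm_intCast_le a) (circNorm_intCast_le b)

theorem exists_wordNorm_eq_natAbs (k : ℕ) (j : ZMod n) :
    ∃ a b : ℤ, j = (a : ZMod n) + (b : ZMod n) * k ∧ wordNorm n k j = a.natAbs + b.natAbs := by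
  obtain ⟨c, hc⟩ := exists_wordNorm_eq k j
  refine ⟨(j - c * k).valMinAbs, c.valMinAbs, ?_, ?_⟩
  · rw [intCast_valMinAbs, intCast_valMinAbs]; ring
  · rw [hc, add_comm]; rfl

theorem wordNorm_neg (j : ZMod n) : wordNorm n k (-j) = wordNorm n k j := by
  have key : ∀ j : ZMod n, wordNorm n k (-j) ≤ wordNorm n k j := by
    intro j
    obtain ⟨c, hc⟩ := exists_wordNorm_eq k j
    refine (wordNorm_le (-c) (-j)).trans ?_
    rw [hc, circNorm_neg, show -j - -c * (k : ZMod n) = -(j - c * k) by ring, circNorm_neg]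
  exact le_antisymm (key j) (by simpa using key (-j))

theorem outerDist_neg (j : ZMod n) : outerDist n k (-j) = outerDist n k j := by
  rw [outerDist, outerDist, circNorm_neg, wordNorm_neg]

theorem innerDist_neg (j : ZMod n) : innerDist n k (-j) = innerDist n k j := by
  have key : ∀ j : ZMod n, innerDist n k (-j) ≤ innerDist n k j := by
    intro j
    obtain ⟨c, hc⟩ := exists_innerDist_eq k j
    refine (innerDist_le (-c) (-j)).trans ?_
    rw [hc, circNorm_neg, show -j - -c * (k : ZMod n) = -(j - c * k) by ring, circNorm_neg]
    simp only [neg_mul, neg_inj, le_refl]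
  exact le_antisymm (key j) (by simpa using key (-j))

theorem outerDist_zero : outerDist n k 0 = 0 := by simp [outerDist, circNorm_zero]

theorem innerDist_zero : innerDist n k 0 = 0 := by
  simpa [circNorm_zero] using innerDist_le (k := k) (0 : ZMod n) 0

theorem wordNorm_le_circNorm (j : ZMod n) : wordNorm n k j ≤ circNorm j := by
  simpa [circNorm_zero] using wordNorm_le (k := k) 0 j

theorem wordNorm_add_le (j e : ZMod n) : wordNorm n k (j + e) ≤ wordNorm n k j + circNorm e := by
  obtain ⟨c, hc⟩ := exists_wordNorm_eq k j
  refine (wordNorm_le c (j + e)).trans ?_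
  rw [hc, show j + e - c * (k : ZMod n) = (j - c * k) + e by ring, add_assoc]
  exact Nat.add_le_add_left (circNorm_add_le _ _) _

theorem wordNorm_add_mul_le (j e : ZMod n) :
    wordNorm n k (j + e * k) ≤ wordNorm n k j + circNorm e := by
  obtain ⟨c, hc⟩ := exists_wordNorm_eq k j
  refine (wordNorm_le (c + e) (j + e * k)).trans ?_
  rw [hc, show j + e * k - (c + e) * (k : ZMod n) = j - c * k by ring]
  have := circNorm_add_le c e
  omega

theorem outerDist_add_one_le (j : ZMod n) {e : ZMod n} (he : circNorm e ≤ 1) :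
    outerDist n k (j + e) ≤ outerDist n k j + 1 := by
  have h1 := wordNorm_add_le (k := k) j e
  have h2 := circNorm_add_le j e
  unfold outerDist
  omega

theorem wordNorm_le_innerDist (j : ZMod n) : wordNorm n k j ≤ innerDist n k j := by
  obtain ⟨c, hc⟩ := exists_innerDist_eq k j
  have := wordNorm_le (k := k) c j
  omega

theorem wordNorm_le_outerDist (j : ZMod n) : wordNorm n k j ≤ outerDist n k j := by
  have := wordNorm_le_circNorm (k := k) j
  unfold outerDist
  omega

theorem outerDist_le (j : ZMod n) : outerDist n k j ≤ wordNorm n k j + 2 := min_le_right _ _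

theorem innerDist_le_wordNorm (j : ZMod n) : innerDist n k j ≤ wordNorm n k j + 2 := by
  obtain ⟨c, hc⟩ := exists_wordNorm_eq k j
  have := innerDist_le (k := k) c j
  split_ifs at this <;> omega

theorem innerDist_mul_le (c : ZMod n) : innerDist n k (c * k) ≤ circNorm c := by
  simpa [circNorm_zero] using innerDist_le (k := k) c (c * k)

theorem innerDist_add_mul_le (j : ZMod n) {e : ZMod n} (he : circNorm e ≤ 1) :
    innerDist n k (j + e * k) ≤ innerDist n k j + 1 := by
  obtain ⟨c, hc⟩ := exists_innerDist_eq k j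
  have h := innerDist_le (k := k) (c + e) (j + e * k)
  rw [show j + e * k - (c + e) * (k : ZMod n) = j - c * k by ring, add_mul] at h
  have := circNorm_add_le c e
  simp only [add_left_inj] at h
  omega

end Norms

/-! ### Distance formulas -/

/-- The source of all lower bounds on distances: a candidate distance function that vanishes at `x`
and grows by at most 1 along edges cannot exceed the true distance from `x`. -/
theorem le_add_dist {V : Type*} {G : SimpleGraph V} (hG : G.Connected) {f : V → ℕ}
    (hf : ∀ x y, G.Adj x y → f y ≤ f x + 1) (x y : V) : f y ≤ f x + G.dist x y := by
  obtain ⟨p, hp⟩ := hG.exists_walk_length_eq_dist x y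
  rw [← hp]
  clear hp
  induction p with
  | nil => simp
  | cons h p ih =>
    have := hf _ _ h
    rw [SimpleGraph.Walk.length_cons]
    omega

theorem le_add_one_of_adj {n k : ℕ} {f : ZMod n ⊕ ZMod n → ℕ}
    (h_outer : ∀ i e : ZMod n, circNorm e ≤ 1 → f (Sum.inl (i + e)) ≤ f (Sum.inl i) + 1)
    (h_inner : ∀ i e : ZMod n, circNorm e ≤ 1 → f (Sum.inr (i + e * k)) ≤ f (Sum.inr i) + 1)
    (h_spoke : ∀ i, f (Sum.inl i) ≤ f (Sum.inr i) + 1)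
    (h_spoke' : ∀ i, f (Sum.inr i) ≤ f (Sum.inl i) + 1) (x y : ZMod n ⊕ ZMod n)
    (h : (generalizedPetersen n k).Adj x y) : f y ≤ f x + 1 := by
  have h1 := circNorm_one_le n
  have h2 : circNorm (-1 : ZMod n) ≤ 1 := by rwa [circNorm_neg]
  rw [generalizedPetersen, SimpleGraph.fromRel_adj] at h
  obtain ⟨-, (⟨i, rfl, rfl⟩ | ⟨i, rfl, rfl⟩ | ⟨i, rfl, rfl⟩) |
    (⟨i, rfl, rfl⟩ | ⟨i, rfl, rfl⟩ | ⟨i, rfl, rfl⟩)⟩ := h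
  · exact h_outer i 1 h1
  · simpa using h_inner i 1 h1
  · exact h_spoke' i
  · simpa using h_outer (i + 1) (-1) h2
  · simpa using h_inner (i + k) (-1) h2
  · exact h_spoke i

theorem dist_inl_inr_self_le (n k : ℕ) (i : ZMod n) :
    (generalizedPetersen n k).dist (Sum.inl i) (Sum.inr i) ≤ 1 := by
  refine (SimpleGraph.dist_eq_one_iff_adj.2 ?_).le
  rw [generalizedPetersen, SimpleGraph.fromRel_adj]
  exact ⟨by simp, Or.inl (Or.inr (Or.inr ⟨i, rfl, rfl⟩))⟩

section Distances

variable {n k : ℕ}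

theorem dist_inl_natCast_le (hn : 1 < n) (i : ZMod n) (m : ℕ) :
    (generalizedPetersen n k).dist (Sum.inl i) (Sum.inl (i + m)) ≤ m := by
  induction m with
  | zero => simp
  | succ m ih =>
    have hc := generalizedPetersen_connected n k hn
    refine hc.dist_triangle.trans (add_le_add ih ?_)
    have : Fact (1 < n) := ⟨hn⟩
    refine (SimpleGraph.dist_eq_one_iff_adj.2 ?_).le
    rw [generalizedPetersen, SimpleGraph.fromRel_adj]
    refine ⟨by simp, Or.inl (Or.inl ⟨_, rfl, by push_cast; rw [add_assoc]⟩)⟩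

theorem dist_inr_natCast_le (hn : 1 < n) (i : ZMod n) (m : ℕ) :
    (generalizedPetersen n k).dist (Sum.inr i) (Sum.inr (i + m * k)) ≤ m := by
  induction m with
  | zero => simp
  | succ m ih =>
    have hc := generalizedPetersen_connected n k hn
    refine hc.dist_triangle.trans (add_le_add ih ?_)
    -- If `k` vanishes modulo `n`, the inner step would be a loop, but it does not move the endpoint
    -- either.
    by_cases hk : (k : ZMod n) = 0
    · simp [hk]
    refine (SimpleGraph.dist_eq_one_iff_adj.2 ?_).le
    rw [generalizedPetersen, SimpleGraph.fromRel_adj]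
    refine ⟨?_, Or.inl (Or.inr (Or.inl ⟨_, rfl, by push_cast; ring_nf⟩))⟩
    simp [add_mul, hk]

theorem dist_inl_le (hn : 1 < n) (i j : ZMod n) :
    (generalizedPetersen n k).dist (Sum.inl i) (Sum.inl j) ≤ circNorm (j - i) := by
  obtain ⟨m, hm | hm⟩ := Int.eq_nat_or_neg (j - i).valMinAbs
  · have h : j = i + m := by
      have := intCast_valMinAbs (j - i)
      rw [hm] at this
      push_cast at this
      rw [this]; ring
    rw [circNorm, hm, h]
    simpa using dist_inl_natCast_le hn i m
  · have h : i = j + m := by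
      have := intCast_valMinAbs (j - i)
      rw [hm] at this
      push_cast at this
      linear_combination this
    rw [circNorm, hm, h, SimpleGraph.dist_comm]
    simpa using dist_inl_natCast_le hn j m

theorem dist_inr_mul_le (hn : 1 < n) (i c : ZMod n) :
    (generalizedPetersen n k).dist (Sum.inr i) (Sum.inr (i + c * k)) ≤ circNorm c := by
  obtain ⟨m, hm | hm⟩ := Int.eq_nat_or_neg c.valMinAbs
  · have h : c = m := by
      rw [← intCast_valMinAbs c, hm]; simp
    rw [circNorm, hm, h]
    simpa using dist_inr_natCast_le hn i m
  · have h : c = -m := by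
      rw [← intCast_valMinAbs c, hm]; simp
    rw [circNorm, hm, h, SimpleGraph.dist_comm]
    simpa using dist_inr_natCast_le (k := k) hn (i + -m * k) m

variable [NeZero n]

theorem dist_inl_inr (hn : 1 < n) (i j : ZMod n) :
    (generalizedPetersen n k).dist (Sum.inl i) (Sum.inr j) = wordNorm n k (j - i) + 1 := by
  have hc := generalizedPetersen_connected n k hn
  apply le_antisymm
  · obtain ⟨c, hc'⟩ := exists_wordNorm_eq k (j - i)
    have h1 := dist_inl_le (k := k) hn i (j - c * k)
    have h2 := dist_inl_inr_self_le n k (j - c * k)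
    have h3 := dist_inr_mul_le (k := k) hn (j - c * k) c
    rw [sub_add_cancel] at h3
    rw [show j - c * (k : ZMod n) - i = j - i - c * k by ring] at h1
    have h4 := hc.dist_triangle (u := Sum.inl i) (v := Sum.inl (j - c * k)) (w := Sum.inr j)
    have h5 := hc.dist_triangle (u := Sum.inl (j - c * k)) (v := Sum.inr (j - c * k))
      (w := Sum.inr j)
    omega
  · have := le_add_dist hc (f := Sum.elim (fun j => outerDist n k (j - i))
      (fun j => wordNorm n k (j - i) + 1)) (le_add_one_of_adj ?_ ?_ ?_ ?_) (Sum.inl i) (Sum.inr j)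
    · simpa [outerDist_zero] using this
    · intro j e he
      simpa [add_sub_right_comm] using outerDist_add_one_le (j - i) he
    · intro j e he
      have := wordNorm_add_mul_le (k := k) (j - i) e
      simp only [Sum.elim_inr, add_sub_right_comm]
      omega
    · intro j
      exact outerDist_le _
    · intro j
      have := wordNorm_le_outerDist (k := k) (j - i)
      simp only [Sum.elim_inl, Sum.elim_inr]
      omega

theorem dist_inr_inl (hn : 1 < n) (i j : ZMod n) :
    (generalizedPetersen n k).dist (Sum.inr i) (Sum.inl j) = wordNorm n k (j - i) + 1 := by
  rw [SimpleGraph.dist_comm, dist_inl_inr hn, ← wordNorm_neg, neg_sub]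

theorem dist_inl_inl (hn : 1 < n) (i j : ZMod n) :
    (generalizedPetersen n k).dist (Sum.inl i) (Sum.inl j) = outerDist n k (j - i) := by
  have hc := generalizedPetersen_connected n k hn
  apply le_antisymm
  · refine le_min (dist_inl_le hn i j) ?_
    have h1 := dist_inl_inr (k := k) hn i j
    have h2 := dist_inl_inr_self_le n k j
    rw [SimpleGraph.dist_comm] at h2
    have h3 := hc.dist_triangle (u := Sum.inl i) (v := Sum.inr j) (w := Sum.inl j)
    omega
  · have := le_add_dist hc (f := Sum.elim (fun j => outerDist n k (j - i))
      (fun j => wordNorm n k (j - i) + 1)) (le_add_one_of_adj ?_ ?_ ?_ ?_) (Sum.inl i) (Sum.inl j)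
    · simpa [outerDist_zero] using this
    · intro j e he
      simpa [add_sub_right_comm] using outerDist_add_one_le (j - i) he
    · intro j e he
      have := wordNorm_add_mul_le (k := k) (j - i) e
      simp only [Sum.elim_inr, add_sub_right_comm]
      omega
    · intro j
      exact outerDist_le _
    · intro j
      have := wordNorm_le_outerDist (k := k) (j - i)
      simp only [Sum.elim_inl, Sum.elim_inr]
      omega

theorem dist_inr_inr (hn : 1 < n) (i j : ZMod n) :
    (generalizedPetersen n k).dist (Sum.inr i) (Sum.inr j) = innerDist n k (j - i) := by
  have hc := generalizedPetersen_connected n k hn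
  apply le_antisymm
  · obtain ⟨c, hc'⟩ := exists_innerDist_eq k (j - i)
    rw [hc']
    split_ifs with h
    · have := dist_inr_mul_le (k := k) hn i c
      rw [← h, add_sub_cancel] at this
      omega
    · have h0 := wordNorm_le (k := k) c (j - i)
      have h1 := dist_inr_inl (k := k) hn i j
      have h2 := dist_inl_inr_self_le n k j
      have h3 := hc.dist_triangle (u := Sum.inr i) (v := Sum.inl j) (w := Sum.inr j)
      omega
  · have := le_add_dist hc (f := Sum.elim (fun j => wordNorm n k (j - i) + 1)
      (fun j => innerDist n k (j - i))) (le_add_one_of_adj ?_ ?_ ?_ ?_) (Sum.inr i) (Sum.inr j)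
    · simpa [innerDist_zero] using this
    · intro j e he
      have := wordNorm_add_le (k := k) (j - i) e
      simp only [Sum.elim_inl, add_sub_right_comm]
      omega
    · intro j e he
      simpa [add_sub_right_comm] using innerDist_add_mul_le (j - i) he
    · intro j
      have := wordNorm_le_innerDist (k := k) (j - i)
      simp only [Sum.elim_inl, Sum.elim_inr]
      omega
    · intro j
      exact innerDist_le_wordNorm _

end Distances

/-! ### Reduction of balance to a finite sum -/

theorem isBalancedPair_iff_sum_sign_eq_zero {V : Type*} [Fintype V] (G : SimpleGraph V) (x y : V) :
    G.IsBalancedPair x y ↔ ∑ w, ((G.dist w x : ℤ) - G.dist w y).sign = 0 := by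
  classical
  have h : ∀ w, ((G.dist w x : ℤ) - G.dist w y).sign =
      (if G.dist w y < G.dist w x then 1 else 0) - (if G.dist w x < G.dist w y then 1 else 0) := by
    intro w
    rcases lt_trichotomy (G.dist w x) (G.dist w y) with h | h | h
    · rw [Int.sign_eq_neg_one_of_neg (by omega), if_neg (by omega), if_pos h]; rfl
    · simp [h]
    · rw [Int.sign_eq_one_of_pos (by omega), if_pos h, if_neg (by omega)]; rfl
  have hcard : ∀ x y, (G.closerSet x y).ncard = #{w | G.dist w x < G.dist w y} := by
    intro x y
    rw [← Set.ncard_coe_finset]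
    simp [SimpleGraph.closerSet]
  simp only [h, sum_sub_distrib, sum_boole, SimpleGraph.IsBalancedPair, hcard]
  constructor
  · intro h; simp [h]
  · intro h
    have := sub_eq_zero.1 h
    exact_mod_cast this.symm

/-- Two vertices interchanged by a distance-preserving permutation are balanced. -/
theorem isBalancedPair_of_equiv {V : Type*} [Fintype V] (G : SimpleGraph V) {x y : V} (σ : V ≃ V)
    (hx : ∀ w, G.dist (σ w) x = G.dist w y) (hy : ∀ w, G.dist (σ w) y = G.dist w x) :
    G.IsBalancedPair x y := by
  rw [isBalancedPair_iff_sum_sign_eq_zero]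
  have h := Equiv.sum_comp σ fun w => ((G.dist w x : ℤ) - G.dist w y).sign
  simp only [hx, hy] at h
  have h2 : ∑ w, ((G.dist w y : ℤ) - G.dist w x).sign =
      -∑ w, ((G.dist w x : ℤ) - G.dist w y).sign := by
    rw [← sum_neg_distrib]
    exact sum_congr rfl fun w _ => by rw [← Int.sign_neg, neg_sub]
  omega

section Balance

variable {n k : ℕ} [NeZero n]

/-- The reflection `w ↦ i + j - w` of all indices swaps the two vertices and preserves distances to
them. -/
theorem isBalancedPair_inl_inl (hn : 1 < n) (i j : ZMod n) :
    (generalizedPetersen n k).IsBalancedPair (Sum.inl i) (Sum.inl j) := by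
  refine isBalancedPair_of_equiv _
    (Equiv.sumCongr (Equiv.subLeft (i + j)) (Equiv.subLeft (i + j))) ?_ ?_ <;>
  rintro (w | w) <;>
  simp only [Equiv.sumCongr_apply, Sum.map_inl, Sum.map_inr, Equiv.subLeft_apply,
    dist_inl_inl hn, dist_inr_inl hn]
  · rw [← outerDist_neg]; ring_nf
  · rw [← wordNorm_neg]; ring_nf
  · rw [← outerDist_neg]; ring_nf
  · rw [← wordNorm_neg]; ring_nf

theorem isBalancedPair_inr_inr (hn : 1 < n) (i j : ZMod n) :
    (generalizedPetersen n k).IsBalancedPair (Sum.inr i) (Sum.inr j) := by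
  refine isBalancedPair_of_equiv _
    (Equiv.sumCongr (Equiv.subLeft (i + j)) (Equiv.subLeft (i + j))) ?_ ?_ <;>
  rintro (w | w) <;>
  simp only [Equiv.sumCongr_apply, Sum.map_inl, Sum.map_inr, Equiv.subLeft_apply,
    dist_inl_inr hn, dist_inr_inr hn]
  · rw [← wordNorm_neg]; ring_nf
  · rw [← innerDist_neg]; ring_nf
  · rw [← wordNorm_neg]; ring_nf
  · rw [← innerDist_neg]; ring_nf

theorem isBalancedPair_inl_inr_iff (hn : 1 < n) (i s : ZMod n) :
    (generalizedPetersen n k).IsBalancedPair (Sum.inl i) (Sum.inr (i + s)) ↔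
      imbalance n k s = 0 := by
  -- Outer vertices are indexed as `i + j` and inner ones, reflected, as `i + s - j`, so that both
  -- are compared with the same `wordNorm n k (j - s) + 1`.
  rw [isBalancedPair_iff_sum_sign_eq_zero, Fintype.sum_sum_type, imbalance, sum_sub_distrib,
    sub_eq_add_neg, ← sum_neg_distrib, ← Equiv.sum_comp (Equiv.addLeft i),
    ← Equiv.sum_comp (Equiv.subLeft (i + s))
      (fun w => (((generalizedPetersen n k).dist (Sum.inr w) (Sum.inl i) : ℤ) -
        (generalizedPetersen n k).dist (Sum.inr w) (Sum.inr (i + s))).sign)]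
  simp only [Equiv.coe_addLeft, Equiv.subLeft_apply, dist_inl_inl hn, dist_inl_inr hn,
    dist_inr_inl hn, dist_inr_inr hn]
  have h1 : ∀ j : ZMod n, outerDist n k (i - (i + j)) = outerDist n k j := fun j => by
    rw [← outerDist_neg]; ring_nf
  have h2 : ∀ j : ZMod n, wordNorm n k (i + s - (i + j)) = wordNorm n k (j - s) := fun j => by
    rw [← wordNorm_neg]; ring_nf
  have h3 : ∀ j : ZMod n, wordNorm n k (i - (i + s - j)) = wordNorm n k (j - s) := fun j => by
    ring_nf
  have h4 : ∀ j : ZMod n, innerDist n k (i + s - (i + s - j)) = innerDist n k j := fun j => by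
    ring_nf
  simp only [h1, h2, h3, h4, ← Int.sign_neg, neg_sub, Nat.cast_add, Nat.cast_one]

theorem isDistanceBalanced_two_iff (hn : 1 < n) :
    (generalizedPetersen n k).IsDistanceBalanced 2 ↔
      ∀ s : ZMod n, wordNorm n k s = 1 → imbalance n k s = 0 := by
  constructor
  · intro h s hs
    rw [← isBalancedPair_inl_inr_iff hn 0]
    apply h
    rw [dist_inl_inr hn, zero_add, sub_zero, hs]
  · intro h
    have key : ∀ i j : ZMod n, (generalizedPetersen n k).dist (Sum.inl i) (Sum.inr j) = 2 →
        (generalizedPetersen n k).IsBalancedPair (Sum.inl i) (Sum.inr j) := by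
      intro i j hij
      rw [dist_inl_inr hn] at hij
      have := (isBalancedPair_inl_inr_iff (k := k) hn i (j - i)).2 (h _ (by omega))
      rwa [add_sub_cancel] at this
    rintro (i | i) (j | j) hij
    · exact isBalancedPair_inl_inl hn i j
    · exact key i j hij
    · rw [SimpleGraph.dist_comm] at hij
      exact (key j i hij).symm
    · exact isBalancedPair_inr_inr hn i j

end Balance

/-! ### Pointwise bounds on gain and loss -/

/-- The summand of `imbalance n k k` that an outer vertex loses by a path along the outer cycle. -/
def loss (n k : ℕ) [NeZero n] (j : ZMod n) : ℤ :=
  ((wordNorm n k j : ℤ) + 2 - (wordNorm n k (j - k) + 1)).sign -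
    ((outerDist n k j : ℤ) - (wordNorm n k (j - k) + 1)).sign

/-- The summand of `imbalance n k k` that an inner vertex gains by a path along inner cycles. -/
def gain (n k : ℕ) [NeZero n] (j : ZMod n) : ℤ :=
  ((wordNorm n k j : ℤ) + 2 - (wordNorm n k (j - k) + 1)).sign -
    ((innerDist n k j : ℤ) - (wordNorm n k (j - k) + 1)).sign

theorem sign_cases (a : ℤ) :
    0 < a ∧ a.sign = 1 ∨ a = 0 ∧ a.sign = 0 ∨ a < 0 ∧ a.sign = -1 := by
  rcases lt_trichotomy a 0 with h | h | h
  · exact Or.inr (Or.inr ⟨h, Int.sign_eq_neg_one_of_neg h⟩)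
  · exact Or.inr (Or.inl ⟨h, by simp [h]⟩)
  · exact Or.inl ⟨h, Int.sign_eq_one_of_pos h⟩

theorem circNorm_eq_of_valMinAbs {n : ℕ} {x : ZMod n} {j : ℤ} (h : x.valMinAbs = j) :
    x = (j : ZMod n) ∧ circNorm x = j.natAbs :=
  ⟨by rw [← h, intCast_valMinAbs], by rw [circNorm, h]⟩

section Estimates

variable {n k : ℕ} [NeZero n]

theorem imbalance_eq_sum_gain_sub_sum_loss :
    imbalance n k k = ∑ j, gain n k j - ∑ j, loss n k j := by
  rw [imbalance, ← sum_sub_distrib]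
  exact sum_congr rfl fun j _ => by unfold gain loss; ring

theorem wordNorm_sub_le (j : ZMod n) : wordNorm n k (j - k) ≤ wordNorm n k j + 1 := by
  have h := wordNorm_add_mul_le (k := k) j (-1)
  rw [circNorm_neg, neg_one_mul, ← sub_eq_add_neg] at h
  have := circNorm_one_le n
  omega

theorem wordNorm_le_sub (j : ZMod n) : wordNorm n k j ≤ wordNorm n k (j - k) + 1 := by
  have h := wordNorm_add_mul_le (k := k) (j - (k : ZMod n)) 1
  rw [one_mul, sub_add_cancel] at h
  have := circNorm_one_le n
  omega

theorem gain_nonneg (j : ZMod n) : 0 ≤ gain n k j := by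
  unfold gain
  have h := innerDist_le_wordNorm (k := k) j
  rcases sign_cases ((wordNorm n k j : ℤ) + 2 - (wordNorm n k (j - k) + 1)) with h1 | h1 | h1 <;>
  rcases sign_cases ((innerDist n k j : ℤ) - (wordNorm n k (j - k) + 1)) with h2 | h2 | h2 <;>
  omega

theorem one_le_gain {j : ZMod n} (h : innerDist n k j ≤ wordNorm n k j) : 1 ≤ gain n k j := by
  unfold gain
  have h3 := wordNorm_sub_le (k := k) j
  have h4 := wordNorm_le_sub (k := k) j
  rcases sign_cases ((wordNorm n k j : ℤ) + 2 - (wordNorm n k (j - k) + 1)) with h1 | h1 | h1 <;>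
  rcases sign_cases ((innerDist n k j : ℤ) - (wordNorm n k (j - k) + 1)) with h2 | h2 | h2 <;>
  omega

theorem loss_le_two (j : ZMod n) : loss n k j ≤ 2 := by
  unfold loss
  rcases sign_cases ((wordNorm n k j : ℤ) + 2 - (wordNorm n k (j - k) + 1)) with h1 | h1 | h1 <;>
  rcases sign_cases ((outerDist n k j : ℤ) - (wordNorm n k (j - k) + 1)) with h2 | h2 | h2 <;>
  omega

/-- In the first case the outer path is no shortcut, so `outerDist` is word length plus 2. In the
second, either that holds again or `outerDist` exceeds `wordNorm n k (j - k) + 1`, so its sign is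
already 1. -/
theorem loss_nonpos {j : ZMod n}
    (h : wordNorm n k j + 2 ≤ circNorm j ∨ wordNorm n k (j - k) + 2 ≤ circNorm j) :
    loss n k j ≤ 0 := by
  unfold loss
  have h3 := outerDist_le (k := k) j
  have h4 : outerDist n k j = min (circNorm j) (wordNorm n k j + 2) := rfl
  rcases sign_cases ((wordNorm n k j : ℤ) + 2 - (wordNorm n k (j - k) + 1)) with h1 | h1 | h1 <;>
  rcases sign_cases ((outerDist n k j : ℤ) - (wordNorm n k (j - k) + 1)) with h2 | h2 | h2 <;>
  omega

/-- A loss of 2 needs the signs 1 and -1, which squeeze `wordNorm n k j`, `outerDist n k j` and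
`wordNorm n k (j - k)` to one value, equal to `circNorm j`. -/
theorem loss_le_one {j : ZMod n}
    (h : wordNorm n k j ≠ circNorm j ∨ wordNorm n k (j - k) ≠ circNorm j) :
    loss n k j ≤ 1 := by
  unfold loss
  have h3 := wordNorm_sub_le (k := k) j
  have h4 := wordNorm_le_sub (k := k) j
  have h5 := wordNorm_le_circNorm (k := k) j
  have h6 : outerDist n k j = min (circNorm j) (wordNorm n k j + 2) := rfl
  rcases sign_cases ((wordNorm n k j : ℤ) + 2 - (wordNorm n k (j - k) + 1)) with h1 | h1 | h1 <;>
  rcases sign_cases ((outerDist n k j : ℤ) - (wordNorm n k (j - k) + 1)) with h2 | h2 | h2 <;>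
  omega

/-- A shorter word `a + c * k` would make `a + (c - b) * k` a multiple of `n` too small to be
nonzero. Then `|a| = |b - c| * k ≥ |b - c|`, so `|a| + |c| ≥ |b|` after all. -/
theorem natAbs_le_wordNorm_mul {b : ℤ} (hk : 0 < k) (hb : (2 * b.natAbs - 1 : ℤ) * k < n) :
    b.natAbs ≤ wordNorm n k (b * k) := by
  obtain ⟨a, c, h, hw⟩ := exists_wordNorm_eq_natAbs k ((b : ZMod n) * (k : ZMod n))
  rw [hw]
  by_contra! hlt
  have hd : (n : ℤ) ∣ a + (c - b) * k := by
    rw [← ZMod.intCast_zmod_eq_zero_iff_dvd _ n]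
    push_cast
    linear_combination -h
  have hk' : (1 : ℤ) ≤ k := by exact_mod_cast hk
  have hsmall : |a + (c - b) * (k : ℤ)| < n := by
    refine lt_of_le_of_lt ?_ hb
    calc |a + (c - b) * (k : ℤ)| ≤ |a| + |c - b| * k := by
          refine (abs_add_le _ _).trans ?_
          rw [abs_mul, Nat.abs_cast]
      _ ≤ |a| * k + |c - b| * k := by
          have := le_mul_of_one_le_right (abs_nonneg a) hk'
          linarith
      _ = (|a| + |c - b|) * k := by ring
      _ ≤ (2 * b.natAbs - 1 : ℤ) * k := by
          apply mul_le_mul_of_nonneg_right _ (by omega)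
          simp only [Int.abs_eq_natAbs]
          omega
  have h0 := Int.eq_zero_of_abs_lt_dvd hd hsmall
  have ha : |a| = |b - c| * k := by
    rw [show a = (b - c) * (k : ℤ) by linear_combination h0, abs_mul, Nat.abs_cast]
  have := le_mul_of_one_le_right (abs_nonneg (b - c)) hk'
  rw [← ha] at this
  simp only [Int.abs_eq_natAbs] at this
  omega

/-- Rules out a loss of 2 left of `k / 2`. Again a word of length at most `|j|` is too short to wrap
around modulo `n`, and over the integers no such word exists. -/
theorem natAbs_lt_wordNorm_sub {j : ℤ} (hj : -(k + 1 : ℤ) ≤ 2 * j) (hj' : 2 * j < k)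
    (hn : k * k + 2 * k < n) : j.natAbs < wordNorm n k (j - k) := by
  obtain ⟨a, b, h, hw⟩ := exists_wordNorm_eq_natAbs k ((j : ZMod n) - (k : ZMod n))
  rw [hw]
  by_contra! hle
  have hd : (n : ℤ) ∣ a + (b + 1) * k - j := by
    rw [← ZMod.intCast_zmod_eq_zero_iff_dvd _ n]
    push_cast
    linear_combination -h
  have hk : (1 : ℤ) ≤ k := by omega
  have hn' : (k : ℤ) * k + 2 * k < n := by exact_mod_cast hn
  have hsmall : |a + (b + 1) * (k : ℤ) - j| < n := by
    have h1 : |a + (b + 1) * (k : ℤ) - j| ≤ |a| + |b| * k + k + |j| := by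
      have e : |b * (k : ℤ)| = |b| * k := by rw [abs_mul, Nat.abs_cast]
      rw [add_mul, ← e]
      simp only [Int.abs_eq_natAbs]
      omega
    have h2 : |a| + |b| * (k : ℤ) ≤ |j| * k := by
      have := le_mul_of_one_le_right (abs_nonneg a) hk
      have h3 : (|a| + |b|) * (k : ℤ) ≤ |j| * k :=
        mul_le_mul_of_nonneg_right (by simp only [Int.abs_eq_natAbs]; omega) (by omega)
      linarith
    have h4 : 2 * |j| ≤ k + 1 := by rw [Int.abs_eq_natAbs]; omega
    nlinarith
  have h0 := Int.eq_zero_of_abs_lt_dvd hd hsmall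
  obtain hb | hb | hb : b + 1 = 0 ∨ 0 ≤ b ∨ b + 2 ≤ 0 := by omega
  · rw [hb] at h0
    omega
  · have := mul_nonneg hb (by omega : (0 : ℤ) ≤ k)
    rw [add_mul] at h0
    omega
  · have := mul_nonneg (neg_nonneg.2 hb) (by omega : (0 : ℤ) ≤ k)
    rw [show -(b + 2) * (k : ℤ) = -((b + 1) * k) - k by ring] at this
    omega

/-! ### Total gain against total loss -/

theorem le_sum_gain (hk : 0 < k) (B : ℕ) (hB : (2 * B - 1 : ℤ) * k < n) :
    (2 * B : ℤ) ≤ ∑ j, gain n k j := by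
  classical
  have hk' : (1 : ℤ) ≤ k := by exact_mod_cast hk
  -- The half-open interval has `2 * B` elements with differences at most `2 * B - 1`, exactly what
  -- `hB` keeps distinct modulo `n`.
  have hinj : Set.InjOn (fun b : ℤ => ((b : ZMod n) * k)) (Ioc (-(B : ℤ)) B) := by
    intro b hb c hc hbc
    simp only [coe_Ioc, Set.mem_Ioc] at hb hc
    have hd : (n : ℤ) ∣ (b - c) * k := by
      rw [← ZMod.intCast_zmod_eq_zero_iff_dvd _ n]
      push_cast
      linear_combination hbc
    have h0 := Int.eq_zero_of_abs_lt_dvd hd (by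
      rw [abs_mul, Nat.abs_cast]
      refine lt_of_le_of_lt ?_ hB
      apply mul_le_mul_of_nonneg_right _ (by omega)
      rw [abs_le]
      omega)
    rcases mul_eq_zero.1 h0 with h | h <;> omega
  calc (2 * B : ℤ) = ∑ b ∈ Ioc (-(B : ℤ)) B, 1 := by simp; omega
    _ ≤ ∑ b ∈ Ioc (-(B : ℤ)) B, gain n k ((b : ZMod n) * k) := by
        refine sum_le_sum fun b hb => one_le_gain ?_
        rw [mem_Ioc] at hb
        refine (innerDist_mul_le _).trans ((circNorm_intCast_le b).trans ?_)
        apply natAbs_le_wordNorm_mul hk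
        refine lt_of_le_of_lt ?_ hB
        apply mul_le_mul_of_nonneg_right _ (by omega)
        omega
    _ = ∑ j ∈ (Ioc (-(B : ℤ)) B).image (fun b : ℤ => ((b : ZMod n) * k)), gain n k j :=
        (sum_image hinj).symm
    _ ≤ ∑ j, gain n k j :=
        sum_le_sum_of_subset_of_nonneg (subset_univ _) fun j _ _ => gain_nonneg j

theorem loss_nonpos_of_lt (hk : 2 ≤ k) {x : ZMod n} (hx : (k + 1 : ℤ) < 2 * x.valMinAbs) :
    loss n k x ≤ 0 := by
  obtain ⟨h1, h2⟩ := circNorm_eq_of_valMinAbs (x := x) rfl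
  apply loss_nonpos
  right
  have := wordNorm_le_of_eq (k := k) (j := x - (k : ZMod n)) (x.valMinAbs - k) 0 (by
    simp)
  omega

theorem wordNorm_lt_circNorm (hk : 2 ≤ k) {x : ZMod n} (hx : 2 * x.valMinAbs < -(k + 1 : ℤ)) :
    wordNorm n k x < circNorm x := by
  obtain ⟨h1, h2⟩ := circNorm_eq_of_valMinAbs (x := x) rfl
  have := wordNorm_le_of_eq (k := k) (j := x) (x.valMinAbs + k) (-1) (by
    simp)
  omega

theorem loss_le_one_of_ne (hk : 2 ≤ k) (hn : k * k + 2 * k < n) {x : ZMod n}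
    (hx : 2 * x.valMinAbs ≠ k) : loss n k x ≤ 1 := by
  obtain ⟨h1, h2⟩ := circNorm_eq_of_valMinAbs (x := x) rfl
  obtain h | h | h : 2 * x.valMinAbs < -(k + 1 : ℤ) ∨
      (-(k + 1 : ℤ) ≤ 2 * x.valMinAbs ∧ 2 * x.valMinAbs < k) ∨ (k : ℤ) < 2 * x.valMinAbs := by
    omega
  · exact loss_le_one (Or.inl (wordNorm_lt_circNorm hk h).ne)
  · apply loss_le_one
    right
    have := natAbs_lt_wordNorm_sub (n := n) h.1 h.2 hn
    rw [← h1] at this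
    omega
  · apply loss_le_one
    right
    have := wordNorm_le_of_eq (k := k) (j := x - (k : ZMod n)) (x.valMinAbs - k) 0 (by
      simp)
    omega

/-- The total loss is at most the length of an interval that supports it, plus one if `k` is even
for the contribution of `k / 2`. -/
theorem sum_loss_le (hk : 2 ≤ k) (hn : k * k + 2 * k < n) (l : ℕ)
    (hl : ∀ x : ZMod n, x.valMinAbs < -(l : ℤ) → loss n k x ≤ 0) :
    ∑ j, loss n k j ≤ l + ((k + 1) / 2 : ℕ) + 1 + (if Even k then 1 else 0) := by
  classical
  set I : Finset ℤ := Icc (-(l : ℤ)) ((k + 1) / 2 : ℕ) with hI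
  let g : ℤ → ℤ := fun i => (if i ∈ I then 1 else 0) +
    (if i = (k / 2 : ℕ) ∧ Even k then 1 else 0)
  have hg : ∀ i, 0 ≤ g i := fun i => by simp only [g]; split_ifs <;> simp
  have hle : ∀ x : ZMod n, loss n k x ≤ g x.valMinAbs := by
    intro x
    by_cases hxI : x.valMinAbs ∈ I
    · by_cases hx : 2 * x.valMinAbs = k
      · have h2 : x.valMinAbs = (k / 2 : ℕ) ∧ Even k :=
          ⟨by omega, by rw [Nat.even_iff]; omega⟩
        simp only [g, if_pos hxI, if_pos h2]
        exact loss_le_two x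
      · refine (loss_le_one_of_ne hk hn hx).trans ?_
        simp only [g, if_pos hxI]
        split_ifs <;> simp
    · refine le_trans ?_ (hg _)
      rw [hI, mem_Icc, not_and_or, not_le, not_le] at hxI
      rcases hxI with h | h
      · exact hl x h
      · exact loss_nonpos_of_lt hk (by omega)
  set J : Finset ℤ := univ.image (fun x : ZMod n => x.valMinAbs)
  calc ∑ x, loss n k x ≤ ∑ x : ZMod n, g x.valMinAbs := sum_le_sum fun x _ => hle x
    _ = ∑ i ∈ J, g i := (sum_image fun x _ y _ h => ZMod.valMinAbs_inj.1 h).symm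
    -- Enlarging the index set to contain the support of `g` makes the sum computable.
    _ ≤ ∑ i ∈ J ∪ (I ∪ {((k / 2 : ℕ) : ℤ)}), g i :=
        sum_le_sum_of_subset_of_nonneg subset_union_left fun i _ _ => hg i
    _ = _ := by
        simp only [g, sum_add_distrib]
        congr 1
        · rw [sum_ite_mem, inter_eq_right.2 (subset_union_left.trans subset_union_right), hI]
          simp
          omega
        · by_cases hev : Even k <;> simp [hev, sum_ite_eq']

theorem loss_nonpos_of_lt_neg (hk : 3 ≤ k) {x : ZMod n}
    (hx : x.valMinAbs < -((k / 2 + 1 : ℕ) : ℤ)) : loss n k x ≤ 0 := by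
  obtain ⟨h1, h2⟩ := circNorm_eq_of_valMinAbs (x := x) rfl
  apply loss_nonpos
  left
  have := wordNorm_le_of_eq (k := k) (j := x) (x.valMinAbs + k) (-1) (by
    simp)
  omega

theorem loss_two_nonpos_of_lt_neg {x : ZMod n} (hx : x.valMinAbs < -((3 : ℕ) : ℤ)) :
    loss n 2 x ≤ 0 := by
  obtain ⟨h1, h2⟩ := circNorm_eq_of_valMinAbs (x := x) rfl
  apply loss_nonpos
  left
  -- One inner step for `k = 2` saves only 1 over the outer path; two are needed to save 2.
  have := wordNorm_le_of_eq (k := 2) (j := x) (x.valMinAbs + 4) (-2) (by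
    push_cast; ring)
  omega

theorem imbalance_pos (hk : 2 ≤ k) (hn : k * k + 2 * k < n) (l B : ℕ)
    (hl : ∀ x : ZMod n, x.valMinAbs < -(l : ℤ) → loss n k x ≤ 0)
    (hB : (2 * B - 1 : ℤ) * k < n)
    (hlB : l + (k + 1) / 2 + 1 + (if Even k then 1 else 0) < 2 * B) : 0 < imbalance n k k := by
  have h1 := sum_loss_le hk hn l hl
  have h2 := le_sum_gain (n := n) (by omega) B hB
  rw [imbalance_eq_sum_gain_sub_sum_loss]
  split_ifs at h1 hlB <;> omega

theorem imbalance_pos_of_even (hk : 3 ≤ k) (hev : Even k) (hn : k * k + 3 * k < n) :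
    0 < imbalance n k k := by
  have h2 := Nat.even_iff.1 hev
  -- The loss is at most `k + 3`, and `2 * B = k + 4` is the next even number.
  refine imbalance_pos (by omega) (by omega) (k / 2 + 1) (k / 2 + 2)
    (fun x hx => loss_nonpos_of_lt_neg hk hx) ?_ (by rw [if_pos hev]; omega)
  have h3 : (2 * ((k / 2 + 2 : ℕ) : ℤ) - 1) = k + 3 := by omega
  rw [h3, add_mul]
  exact_mod_cast hn

theorem imbalance_pos_of_odd (hk : 3 ≤ k) (hodd : Odd k) (hn : k * k + 2 * k < n) :
    0 < imbalance n k k := by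
  have h2 := Nat.odd_iff.1 hodd
  -- The loss is at most `k + 2`, and `2 * B = k + 3`.
  refine imbalance_pos (by omega) hn (k / 2 + 1) (k / 2 + 2)
    (fun x hx => loss_nonpos_of_lt_neg hk hx) ?_
    (by rw [if_neg (Nat.not_even_iff_odd.2 hodd)]; omega)
  have h3 : (2 * ((k / 2 + 2 : ℕ) : ℤ) - 1) = k + 2 := by omega
  rw [h3, add_mul]
  exact_mod_cast hn

theorem imbalance_two_pos (hn : 14 < n) : 0 < imbalance n 2 (2 : ℕ) :=
  imbalance_pos le_rfl (by omega) 3 4 (fun _ hx => loss_two_nonpos_of_lt_neg hx)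
    (by push_cast; omega) (by decide)

theorem not_isDistanceBalanced_two (hn : 1 < n) (hk : 0 < k) (hkn : k < n)
    (h : imbalance n k k ≠ 0) : ¬ (generalizedPetersen n k).IsDistanceBalanced 2 := by
  rw [isDistanceBalanced_two_iff hn]
  intro hall
  refine h (hall k (le_antisymm ?_ ?_))
  · simpa using wordNorm_le_of_eq (n := n) (k := k) (j := k) 0 1 (by simp)
  · obtain ⟨a, b, h1, h2⟩ := exists_wordNorm_eq_natAbs (n := n) k k
    by_contra h3
    obtain rfl : a = 0 := by omega
    obtain rfl : b = 0 := by omega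
    simp only [Int.cast_zero, zero_mul, add_zero] at h1
    exact Nat.not_dvd_of_pos_of_lt hk hkn ((ZMod.natCast_eq_zero_iff k n).1 h1)

end Estimates

end GeneralizedPetersen

/-! ### Stated thresholds and small cases -/

open GeneralizedPetersen

theorem theorem1p5 :
    (∀ n k : ℕ, 2 ≤ k → 2 * k < n →
      (6 ≤ k → Even k → (5 / 4 : ℝ) * (k : ℝ) ^ 2 + 2 * (k : ℝ) < (n : ℝ) →
        ¬ (generalizedPetersen n k).IsDistanceBalanced 2) ∧
      (5 ≤ k → Odd k → (7 / 4 : ℝ) * (k : ℝ) ^ 2 + (3 / 4 : ℝ) * (k : ℝ) < (n : ℝ) →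
        ¬ (generalizedPetersen n k).IsDistanceBalanced 2) ∧
      ((k = 2 ∧ 10 < n) ∨ (k = 3 ∧ 10 < n) ∨ (k = 4 ∧ 21 < n) →
        ¬ (generalizedPetersen n k).IsDistanceBalanced 2)) ∧
    (generalizedPetersen 10 2).IsDistanceBalanced 2 ∧
    (generalizedPetersen 10 3).IsDistanceBalanced 2 ∧
    (generalizedPetersen 21 4).IsDistanceBalanced 2 := by
  refine ⟨fun n k hk hkn => ?_, ?_, ?_, ?_⟩
  · refine ⟨fun h6 hev hn => ?_, fun h5 hodd hn => ?_, ?_⟩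
    · have : NeZero n := ⟨by omega⟩
      refine not_isDistanceBalanced_two (by omega) (by omega) (by omega)
        (imbalance_pos_of_even (by omega) hev ?_).ne'
      have h6' : (6 : ℝ) ≤ k := by exact_mod_cast h6
      -- The stated threshold dominates this one as soon as `k ≥ 4`.
      have : (k : ℝ) * k + 3 * k < n := by nlinarith
      exact_mod_cast this
    · have : NeZero n := ⟨by omega⟩
      refine not_isDistanceBalanced_two (by omega) (by omega) (by omega)
        (imbalance_pos_of_odd (by omega) hodd ?_).ne'
      have h5' : (5 : ℝ) ≤ k := by exact_mod_cast h5
      have : (k : ℝ) * k + 2 * k < n := by nlinarith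
      exact_mod_cast this
    · rintro (⟨rfl, hn⟩ | ⟨rfl, hn⟩ | ⟨rfl, hn⟩)
      · rcases lt_or_ge 14 n with h | h
        · have : NeZero n := ⟨by omega⟩
          exact not_isDistanceBalanced_two (by omega) (by omega) (by omega)
            (imbalance_two_pos h).ne'
        -- For these `n` the pairs with `s = 1` are used as witnesses instead of `s = k`.
        · interval_cases n <;>
          exact fun hall => absurd ((isDistanceBalanced_two_iff (by omega)).1 hall 1
            (by decide +kernel)) (by decide +kernel)
      · rcases lt_or_ge 15 n with h | h
        · have : NeZero n := ⟨by omega⟩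
          exact not_isDistanceBalanced_two (by omega) (by omega) (by omega)
            (imbalance_pos_of_odd le_rfl (by decide) (by omega)).ne'
        · interval_cases n <;>
          exact not_isDistanceBalanced_two (by omega) (by omega) (by omega) (by decide +kernel)
      · rcases lt_or_ge 28 n with h | h
        · have : NeZero n := ⟨by omega⟩
          exact not_isDistanceBalanced_two (by omega) (by omega) (by omega)
            (imbalance_pos_of_even (by omega) (by decide) (by omega)).ne'
        · interval_cases n <;>
          exact not_isDistanceBalanced_two (by omega) (by omega) (by omega) (by decide +kernel)
  · exact (isDistanceBalanced_two_iff (by omega)).2 (by decide +kernel)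
  · exact (isDistanceBalanced_two_iff (by omega)).2 (by decide +kernel)
  · exact (isDistanceBalanced_two_iff (by omega)).2 (by decide +kernel)
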